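/- \textbf{Setting.} Let $T>0$, $M\ge 1$, $\Delta t=T/M$ and $t_i=i\,\Delta t$ ($0\le i\le M$). Between consecutive dates $t_i$ the amounts $S_t$ (stock index) and $B_t$ (bond index) follow $$\frac{dS_t}{S_{t^-}}=(\mu^s-\lambda^s\kappa^s)\,dt+\sigma^s dZ^s+d\Bigl(\sum_{i=1}^{\pi^s_t}(\xi^s_i-1)\Bigr),\qquad \frac{dB_t}{B_{t^-}}=(\mu^b-\lambda^b\kappa^b+\mu^b_c\mathbf 1_{\{B_{t^-}<0\}})\,dt+\sigma^b dZ^b+d\Bigl(\sum_{i=1}^{\pi^b_t}(\xi^b_i-1)\Bigr),$$ where $\sigma^s,\sigma^b>0$, $Z^s,Z^b$ are Wiener processes with $dZ^s dZ^b=\rho\,dt$, $\rho\in[-1,1]$; $\pi^s,\pi^b$ are Poisson processes with intensities $\lambda^s,\lambda^b>0$; the $\xi^s_i$ (resp. $\xi^b_i$) are i.i.d. and $y=\log\xi$ has density $p_u\eta_1e^{-\eta_1y}\mathbf 1_{y\ge0}+(1-p_u)\eta_2e^{\eta_2y}\mathbf 1_{y<0}$ with $p_u\in[0,1]$, $\eta_1>1$,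 $\eta_2>0$ (parameters depending on the asset); $\kappa^s=E[\xi^s-1]$, $\kappa^b=E[\xi^b-1]$; the jump counts and the jump sizes of both assets are mutually independent and independent of $(Z^s,Z^b)$. A control $\mathcal P=\{(q_i,p_i)\}_{0\le i\le M}$ consists of measurable functions of the state $X(t_i^-)=(S(t_i^-),B(t_i^-))$. At $t_i$ the amount $q_i$ is withdrawn, leaving $W_i^+=S(t_i^-)+B(t_i^-)-q_i$, and then $S(t_i^+)=p_iW_i^+$, $B(t_i^+)=(1-p_i)W_i^+$. The control is admissible ($\mathcal P\in\mathcal A$) if $q_i\in[q_{\min},q_{\max}]$ (where $q_{\min}\le q_{\max}$) and $p_i\in[0,1]$ when $W_i^+>0$ and $i<M$, $p_i=0$ otherwise. $\mathcal P_n$ denotes the tail of $\mathcal P$ on $t_n,\dots,t_M$, $\mathcal A_n$ the set of admissible tails, and $W_T=W_M^+$. Let $\kappa>0$ and $0<\alpha<1$. The pre-commitment EW-ES problem is $$J(s,b,t_0^-)=\sup_{\mathcal P\in\mathcal A}\ \sup_{W'\in\mathbb R}E_{\mathcal P}\Bigl[\sum_{i=0}^Mq_i+\kappa\Bigl(W'+\tfrac1\alpha\min(W_T-W',0)\Bigr)\,\Big|\,X(t_0^-)=(s,b)\Bigr].$$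 For a real number $W^*$ the problem $\mathit{TCEQ}_{t_n}(\kappa/\alpha)$ is $$\tilde J(s,b,t_n^-)=\sup_{\mathcal P_n\in\mathcal A_n}E_{\mathcal P_n}\Bigl[\sum_{i=n}^Mq_i+\tfrac\kappa\alpha\min(W_T-W^*,0)\,\Big|\,X(t_n^-)=(s,b)\Bigr].$$ A control $\mathcal P$ is called a time consistent optimal control of $\mathit{TCEQ}(\kappa/\alpha)$ if, for every $0\le n\le M$ and every state $(s,b)$, its tail $\mathcal P_n$ attains $\tilde J(s,b,t_n^-)$. \textbf{Proposition} (pre-commitment strategy equivalence to a time consistent policy). Let the initial wealth be $W_0\in\mathbb R$, held as $X(t_0^-)=(0,W_0)$, and let $W^*$ be a maximizer over $W'\in\mathbb R$ of $$W'\mapsto\sup_{\mathcal P\in\mathcal A}E_{\mathcal P}\Bigl[\sum_{i=0}^Mq_i+\kappa\Bigl(W'+\tfrac1\alpha\min(W_T-W',0)\Bigr)\,\Big|\,X(t_0^-)=(0,W_0)\Bigr].$$ Keep this $W^*$ fixed in $\mathit{TCEQ}(\kappa/\alpha)$. Then for every $\mathcal P^*\in\mathcal A$ the following are equivalent: (i)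 $\mathcal P^*$ is pre-commitment optimal, i.e. $(\mathcal P^*,W^*)$ attains $J(0,W_0,t_0^-)$; (ii) $\mathcal P^*$ is implementable for $\mathit{TCEQ}(\kappa/\alpha)$: for every $0\le n\le M$, almost surely, the tail $\mathcal P^*_n$ is optimal for $\mathit{TCEQ}_{t_n}(\kappa/\alpha)$ in the state $X(t_n^-)$ reached under $\mathcal P^*$ from $(0,W_0)$; (iii) there is a time consistent optimal control of $\mathit{TCEQ}(\kappa/\alpha)$ with which $\mathcal P^*$ coincides almost surely at all dates $t_0,\dots,t_M$ along its own trajectory started from $(0,W_0)$. -/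

import Mathlib

open MeasureTheory ProbabilityTheory
open scoped NNReal ENNReal

namespace EWES

noncomputable section

/-! ### Double exponential jumps -/

/-- Parameters of one jump diffusion `dX / X₋ = (μ - λ E[ξ - 1]) dt + σ dZ + d (∑ (ξ_i - 1))`
with Poisson intensity `lam` and double exponential log-jumps `log ξ_i`. The condition `1 < eta1`
says that the jump multiplier `ξ` has a finite mean. -/
structure KouParams where
  mu : ℝ
  sigma : ℝ
  lam : ℝ
  pu : ℝ
  eta1 : ℝ
  eta2 : ℝ
  sigma_pos : 0 < sigma
  lam_pos : 0 < lam
  pu_nonneg : 0 ≤ pu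
  pu_le_one : pu ≤ 1
  one_lt_eta1 : 1 < eta1
  eta2_pos : 0 < eta2

/-- The density `p_u η₁ e^{-η₁ y} 1_{y ≥ 0} + (1 - p_u) η₂ e^{η₂ y} 1_{y < 0}` of `log ξ`. -/
def KouParams.jumpDensity (a : KouParams) (y : ℝ) : ℝ :=
  if 0 ≤ y then a.pu * a.eta1 * Real.exp (-a.eta1 * y)
  else (1 - a.pu) * a.eta2 * Real.exp (a.eta2 * y)

/-- The law of the log-jump `log ξ`. -/
def KouParams.jumpLaw (a : KouParams) : Measure ℝ :=
  volume.withDensity (fun y => ENNReal.ofReal (a.jumpDensity y))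

/-- The mean relative jump size `E[ξ - 1]`. -/
def KouParams.jumpMean (a : KouParams) : ℝ :=
  ∫ y, (Real.exp y - 1) ∂a.jumpLaw

instance (a : KouParams) : IsProbabilityMeasure a.jumpLaw := by
  have h1 : 0 < a.eta1 := lt_trans one_pos a.one_lt_eta1
  have h2 := a.eta2_pos
  have hp : 0 ≤ 1 - a.pu := sub_nonneg.2 a.pu_le_one
  constructor
  rw [KouParams.jumpLaw, withDensity_apply _ MeasurableSet.univ, Measure.restrict_univ,
    ← lintegral_add_compl _ (measurableSet_Ici (a := (0 : ℝ))), Set.compl_Ici]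
  have e1 : ∫⁻ y in Set.Ici (0 : ℝ), ENNReal.ofReal (a.jumpDensity y) = ENNReal.ofReal a.pu := by
    rw [setLIntegral_congr_fun (g := fun y => ENNReal.ofReal
      (a.pu * a.eta1 * Real.exp (-a.eta1 * y))) measurableSet_Ici
      (fun y hy => by simp only [KouParams.jumpDensity, if_pos (Set.mem_Ici.1 hy)]),
      setLIntegral_congr Ioi_ae_eq_Ici.symm, ← ofReal_integral_eq_lintegral_ofReal]
    · rw [integral_const_mul, integral_exp_mul_Ioi (by linarith)]
      congr 1
      field_simp
      simp
    · exact (integrableOn_exp_mul_Ioi (by linarith) 0).const_mul _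
    · exact Filter.Eventually.of_forall fun y =>
        mul_nonneg (mul_nonneg a.pu_nonneg h1.le) (Real.exp_pos _).le
  have e2 : ∫⁻ y in Set.Iio (0 : ℝ), ENNReal.ofReal (a.jumpDensity y) =
      ENNReal.ofReal (1 - a.pu) := by
    rw [setLIntegral_congr_fun (g := fun y => ENNReal.ofReal
      ((1 - a.pu) * a.eta2 * Real.exp (a.eta2 * y))) measurableSet_Iio
      (fun y hy => by simp only [KouParams.jumpDensity, if_neg (not_le.2 (Set.mem_Iio.1 hy))]),
      setLIntegral_congr Iio_ae_eq_Iic, ← ofReal_integral_eq_lintegral_ofReal]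
    · rw [integral_const_mul, integral_exp_mul_Iic h2]
      congr 1
      field_simp
      simp
    · exact (integrableOn_exp_mul_Iic h2 0).const_mul _
    · exact Filter.Eventually.of_forall fun y =>
        mul_nonneg (mul_nonneg hp h2.le) (Real.exp_pos _).le
  rw [e1, e2, ← ENNReal.ofReal_add a.pu_nonneg hp]
  simp

/-! ### The decumulation problem -/

/-- The data of the decumulation problem: the stock and bond jump diffusions, their Brownian
correlation `rho`, the borrowing spread `muC` charged while the bond amount is negative, the horizon
`T`, the rebalancing dates `t_i = i T / M` (`0 ≤ i ≤ M`), the withdrawal bounds, the scalarization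
parameter `kappa` and the expected shortfall level `alpha`. -/
structure Problem where
  stock : KouParams
  bond : KouParams
  rho : ℝ
  neg_one_le_rho : -1 ≤ rho
  rho_le_one : rho ≤ 1
  muC : ℝ
  T : ℝ
  T_pos : 0 < T
  M : ℕ
  M_pos : 0 < M
  qmin : ℝ
  qmax : ℝ
  qmin_le_qmax : qmin ≤ qmax
  kappa : ℝ
  kappa_pos : 0 < kappa
  alpha : ℝ
  alpha_pos : 0 < alpha
  alpha_lt_one : alpha < 1

/-- A state `(s, b)`: the amounts in the stock index and in the bond index. -/
abbrev State := ℝ × ℝ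

/-- The randomness of one period between consecutive rebalancing dates: two independent Gaussian
variables, and for the stock and for the bond the number of jumps and the sequence of log-jumps. -/
abbrev Noise := (ℝ × ℝ) × (ℕ × (ℕ → ℝ)) × (ℕ × (ℕ → ℝ))

/-- One realization of the randomness of all periods; `ω i` is used on `(t_i, t_{i+1})`. -/
abbrev Path := ℕ → Noise

namespace Problem

variable (D : Problem)

/-- The length `Δt = T / M` of a period. -/
def dt : ℝ := D.T / D.M

/-- The law of one period's randomness: the Gaussians have variance `Δt`, the jump counts are
Poisson with mean `λ Δt`, the log-jumps are i.i.d. double exponential, everything independent. -/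
def noiseLaw : Measure Noise :=
  ((gaussianReal 0 D.dt.toNNReal).prod (gaussianReal 0 D.dt.toNNReal)).prod
    (((poissonMeasure (D.stock.lam * D.dt).toNNReal).prod
        (Measure.infinitePi fun _ : ℕ => D.stock.jumpLaw)).prod
      ((poissonMeasure (D.bond.lam * D.dt).toNNReal).prod
        (Measure.infinitePi fun _ : ℕ => D.bond.jumpLaw)))

instance : IsProbabilityMeasure D.noiseLaw := by
  unfold noiseLaw; infer_instance

/-- The underlying probability measure: the periods are independent. -/
def pathLaw : Measure Path := Measure.infinitePi fun _ : ℕ => D.noiseLaw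

instance : IsProbabilityMeasure D.pathLaw := by
  unfold pathLaw; infer_instance

/-- The increment over one period of the Wiener process `Z^s` of the stock. -/
def dZs (e : Noise) : ℝ := e.1.1

/-- The increment over one period of the Wiener process `Z^b` of the bond: `dZ^s dZ^b = ρ dt`. -/
def dZb (e : Noise) : ℝ := D.rho * e.1.1 + √(1 - D.rho ^ 2) * e.1.2

/-- The stock amount at the end of a period (no control acts inside the period) when it is `s` at
its beginning: the explicit solution of
`dS / S₋ = (μ^s - λ^s κ^s) dt + σ^s dZ^s + d (∑ (ξ_i - 1))`, where `κ^s = E[ξ - 1]`. -/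
def stockEnd (s : ℝ) (e : Noise) : ℝ :=
  s * Real.exp ((D.stock.mu - D.stock.lam * D.stock.jumpMean - D.stock.sigma ^ 2 / 2) * D.dt
      + D.stock.sigma * dZs e)
    * ∏ i ∈ Finset.range e.2.1.1, Real.exp (e.2.1.2 i)

/-- The bond amount at the end of a period when it is `b` at its beginning: the explicit solution of
`dB / B₋ = (μ^b - λ^b κ^b + μ_c 1_{B₋ < 0}) dt + σ^b dZ^b + d (∑ (ξ_i - 1))`; the sign of `B` does
not change inside a period, so the indicator is constant there. -/
def bondEnd (b : ℝ) (e : Noise) : ℝ :=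
  b * Real.exp ((D.bond.mu - D.bond.lam * D.bond.jumpMean + (if b < 0 then D.muC else 0)
        - D.bond.sigma ^ 2 / 2) * D.dt
      + D.bond.sigma * D.dZb e)
    * ∏ i ∈ Finset.range e.2.2.1, Real.exp (e.2.2.2 i)

end Problem

/-! ### Controls -/

/-- A feedback control: at date `t_i` in the state `x = (S(t_i⁻), B(t_i⁻))` the amount `q i x` is
withdrawn, and then the fraction `p i x` of the remaining wealth is put into the stock index. -/
structure Control where
  q : ℕ → State → ℝ
  p : ℕ → State → ℝ

namespace Problem

variable (D : Problem)

/-- The admissible withdrawals `[q_min, q_max]`. -/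
def Zq : Set ℝ := Set.Icc D.qmin D.qmax

open Classical in
/-- The admissible stock fractions at `t_i` when the wealth after withdrawal is `w`: no shorting and
no leverage if solvent, no trading if insolvent, liquidation of the stock at `t_M = T`. -/
def Zp (w : ℝ) (i : ℕ) : Set ℝ :=
  if i ≠ D.M ∧ 0 < w then Set.Icc 0 1 else {0}

/-- The wealth `W(t_i⁺) = S(t_i⁻) + B(t_i⁻) - q_i` after the withdrawal at `t_i`. -/
def wealthAfter (P : Control) (i : ℕ) (x : State) : ℝ := x.1 + x.2 - P.q i x

/-- The set `𝒜_n` of admissible controls on `t_n, …, t_M`; `𝒜 = 𝒜_0`. Only the values `P.q i` and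
`P.p i` with `n ≤ i ≤ M` matter, that is, the tail `P_n` of `P`. -/
def admissible (n : ℕ) : Set Control :=
  {P | ∀ i, n ≤ i → i ≤ D.M → Measurable (P.q i) ∧ Measurable (P.p i) ∧
    ∀ x, P.q i x ∈ D.Zq ∧ P.p i x ∈ D.Zp (wealthAfter P i x) i}

/-- The state `X(t_i⁺)` after withdrawal and rebalancing. -/
def stateAfter (P : Control) (i : ℕ) (x : State) : State :=
  (P.p i x * wealthAfter P i x, (1 - P.p i x) * wealthAfter P i x)

/-- The controlled state `X(t_i⁻)` for `i ≥ n`, given `X(t_n⁻) = x` (and `x` itself for `i < n`). -/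
def stateBefore (P : Control) (n : ℕ) (x : State) (ω : Path) : ℕ → State
  | 0 => x
  | i + 1 =>
    if i < n then x
    else
      (D.stockEnd (stateAfter P i (stateBefore P n x ω i)).1 (ω i),
        D.bondEnd (stateAfter P i (stateBefore P n x ω i)).2 (ω i))

/-- The total withdrawals `∑_{i=n}^M q_i`, given `X(t_n⁻) = x`. -/
def withdrawals (P : Control) (n : ℕ) (x : State) (ω : Path) : ℝ :=
  ∑ i ∈ Finset.Icc n D.M, P.q i (D.stateBefore P n x ω i)

/-- The terminal wealth `W_T` after the final cash flow `q_M`, given `X(t_n⁻) = x`. -/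
def terminalWealth (P : Control) (n : ℕ) (x : State) (ω : Path) : ℝ :=
  wealthAfter P D.M (D.stateBefore P n x ω D.M)

/-! ### The pre-commitment problem -/

/-- `E [∑_{i=0}^M q_i + κ (W* + (1/α) min (W_T - W*, 0)) | X(t_0⁻) = x]` under the control `P`. -/
def preObjective (P : Control) (Wstar : ℝ) (x : State) : ℝ :=
  ∫ ω, (D.withdrawals P 0 x ω
    + D.kappa * (Wstar + 1 / D.alpha * min (D.terminalWealth P 0 x ω - Wstar) 0)) ∂D.pathLaw

/-- The pre-commitment value function `J(x, t_0⁻) = sup_{P ∈ 𝒜} sup_{W*} …`. -/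
def preValue (x : State) : EReal :=
  ⨆ P ∈ D.admissible 0, ⨆ W : ℝ, (D.preObjective P W x : EReal)

/-- The set of maximizers `argmax_{W*} sup_{P ∈ 𝒜} …`. -/
def preArgmax (x : State) : Set ℝ :=
  {W | IsMaxOn (fun W' : ℝ => ⨆ P ∈ D.admissible 0, (D.preObjective P W' x : EReal)) Set.univ W}

/-- `P` is a pre-commitment optimal control from the initial state `x`, with the value `Wstar` of
the outer variable: the pair attains `J(x, t_0⁻)`. -/
def IsPrecommitmentOptimal (P : Control) (Wstar : ℝ) (x : State) : Prop :=
  P ∈ D.admissible 0 ∧ (D.preObjective P Wstar x : EReal) = D.preValue x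

/-! ### The target problem with a fixed `W*` -/

/-- `E [∑_{i=n}^M q_i + c min (W_T - W*, 0) | X(t_n⁻) = x]` under the control `P`. -/
def tceqObjective (c Wstar : ℝ) (P : Control) (n : ℕ) (x : State) : ℝ :=
  ∫ ω, (D.withdrawals P n x ω + c * min (D.terminalWealth P n x ω - Wstar) 0) ∂D.pathLaw

/-- The value function of `TCEQ_{t_n}(c)` at `(x, t_n⁻)`. -/
def tceqValue (c Wstar : ℝ) (n : ℕ) (x : State) : EReal :=
  ⨆ P ∈ D.admissible n, (D.tceqObjective c Wstar P n x : EReal)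

/-- The tail `P_n` of `P` is an optimal control for `TCEQ_{t_n}(c)` in the state `x` at `t_n⁻`. -/
def IsTceqOptimalAt (c Wstar : ℝ) (P : Control) (n : ℕ) (x : State) : Prop :=
  P ∈ D.admissible n ∧ (D.tceqObjective c Wstar P n x : EReal) = D.tceqValue c Wstar n x

/-- `P` is a time consistent optimal control of the problems `TCEQ_{t_n}(c)`, `0 ≤ n ≤ M`: at every
date and in every state its tail is optimal. -/
def IsTceqTimeConsistent (c Wstar : ℝ) (P : Control) : Prop :=
  ∀ n ≤ D.M, ∀ x, D.IsTceqOptimalAt c Wstar P n x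

/-- `P` and `P'` prescribe almost surely the same decisions at all dates `t_0, …, t_M` along the
trajectory of `P` that starts in `x` at `t_0⁻`. -/
def CoincidesAlong (x : State) (P P' : Control) : Prop :=
  ∀ n ≤ D.M, ∀ᵐ ω ∂D.pathLaw,
    P.q n (D.stateBefore P 0 x ω n) = P'.q n (D.stateBefore P 0 x ω n) ∧
    P.p n (D.stateBefore P 0 x ω n) = P'.p n (D.stateBefore P 0 x ω n)

end Problem

end

end EWES

namespace EWES

/-! ### Integrability of the growth factors -/

/-! For an admissible control, the pre-commitment objective at a fixed `W` is the constant `κ W`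
plus the target objective with `c = κ/α`. As `Wstar` maximizes the outer problem, the joint supremum
is already reached by varying the control at `Wstar`. Hence pre-commitment optimality is optimality
for the target problem at `t_0` (`isPrecommitmentOptimal_iff`).

The target objective is additive, so dynamic programming applies. The `gap` of a decision is what it
loses against the Bellman value, and it is nonnegative. Summing over dates telescopes: the Bellman
value minus the performance of a control is the sum of the expected gaps along its trajectory
(`bellman_sub_tceqObjective`). A control is therefore optimal iff its gaps vanish almost surely
along its own trajectory (`isTceqOptimalAt_iff`).

Both equivalences follow. By independence of the periods and Fubini, gaps vanishing along
trajectories from `t_0` also vanish on the trajectories restarted from almost every state reached at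
`t_n`. And since the gap in a state depends only on the decision there, a control can be replaced by
a gap-free one exactly where it has a gap, without altering it almost surely on its trajectory.

The analysis serves to make this rigorous: finite jump means give integrable growth factors, so
value functions stay continuous with linear growth, and measurable maximizers exist. -/

lemma KouParams.measurable_jumpDensity (a : KouParams) : Measurable a.jumpDensity :=
  Measurable.ite measurableSet_Ici (by fun_prop) (by fun_prop)

/-- Against the density, `exp` leaves the exponents `1 - η₁ < 0` on the right tail and `1 + η₂ > 0`
on the left tail. -/
lemma KouParams.integrable_exp_jumpLaw (a : KouParams) : Integrable Real.exp a.jumpLaw := by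
  have hp : 0 ≤ 1 - a.pu := sub_nonneg.2 a.pu_le_one
  have h1 : 0 < a.eta1 := lt_trans one_pos a.one_lt_eta1
  have hnonneg : ∀ y, 0 ≤ a.jumpDensity y := fun y => by
    unfold jumpDensity
    split_ifs
    · exact mul_nonneg (mul_nonneg a.pu_nonneg h1.le) (Real.exp_pos _).le
    · exact mul_nonneg (mul_nonneg hp a.eta2_pos.le) (Real.exp_pos _).le
  rw [jumpLaw, integrable_withDensity_iff a.measurable_jumpDensity.ennreal_ofReal
    (Filter.Eventually.of_forall fun _ => ENNReal.ofReal_lt_top), ← integrableOn_univ,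
    ← Set.Iic_union_Ioi (a := (0 : ℝ)), integrableOn_union]
  constructor
  · rw [integrableOn_Iic_iff_integrableOn_Iio]
    have h : IntegrableOn (fun y => (1 - a.pu) * a.eta2 * Real.exp ((a.eta2 + 1) * y))
        (Set.Iio 0) :=
      ((integrableOn_exp_mul_Iic (by linarith [a.eta2_pos]) 0).mono_set
        Set.Iio_subset_Iic_self).const_mul _
    refine h.congr_fun (fun y hy => ?_) measurableSet_Iio
    rw [ENNReal.toReal_ofReal (hnonneg y)]
    simp only [jumpDensity, if_neg (not_le.2 (Set.mem_Iio.1 hy)),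
      add_mul, Real.exp_add, one_mul]
    ring
  · have h : IntegrableOn (fun y => a.pu * a.eta1 * Real.exp ((-a.eta1 + 1) * y)) (Set.Ioi 0) :=
      (integrableOn_exp_mul_Ioi (by linarith [a.one_lt_eta1]) 0).const_mul _
    refine h.congr_fun (fun y hy => ?_) measurableSet_Ioi
    rw [ENNReal.toReal_ofReal (hnonneg y)]
    simp only [jumpDensity, if_pos (Set.mem_Ioi.1 hy).le,
      add_mul, Real.exp_add, one_mul]
    ring

lemma measurable_jumpFactor :
    Measurable fun z : ℕ × (ℕ → ℝ) => ∏ i ∈ Finset.range z.1, Real.exp (z.2 i) :=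
  measurable_from_prod_countable_right fun n => by
    change Measurable fun y : ℕ → ℝ => ∏ i ∈ Finset.range n, Real.exp (y i)
    fun_prop

lemma KouParams.lintegral_prod_exp (a : KouParams) (n : ℕ) :
    ∫⁻ y, ENNReal.ofReal (∏ i ∈ Finset.range n, Real.exp (y i))
        ∂(Measure.infinitePi fun _ : ℕ => a.jumpLaw) =
      (∫⁻ y, ENNReal.ofReal (Real.exp y) ∂a.jumpLaw) ^ n := by
  have hm : Measurable fun x : ℝ => ENNReal.ofReal (Real.exp x) := by fun_prop
  have h := lintegral_prod_eq_prod_lintegral_of_indepFun (Finset.range n)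
    (fun (i : ℕ) (y : ℕ → ℝ) => ENNReal.ofReal (Real.exp (y i)))
    (iIndepFun_infinitePi (P := fun _ : ℕ => a.jumpLaw) fun _ => hm)
    (fun i => hm.comp (measurable_pi_apply i))
  simp_rw [ENNReal.ofReal_prod_of_nonneg fun _ _ => (Real.exp_pos _).le]
  rw [h, Finset.prod_congr rfl fun i _ => (measurePreserving_eval_infinitePi
    (fun _ : ℕ => a.jumpLaw) i).lintegral_comp hm, Finset.prod_const, Finset.card_range]

/-- Given `n` jumps, independence makes the mean of the product `m ^ n` with `m = E[ξ]`; the Poisson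
weights turn this into a convergent exponential series. -/
lemma KouParams.integrable_jumpFactor (a : KouParams) (r : ℝ≥0) :
    Integrable (fun z : ℕ × (ℕ → ℝ) => ∏ i ∈ Finset.range z.1, Real.exp (z.2 i))
      ((poissonMeasure r).prod (Measure.infinitePi fun _ : ℕ => a.jumpLaw)) := by
  have hpos : ∀ (n : ℕ) (y : ℕ → ℝ), 0 ≤ ∏ i ∈ Finset.range n, Real.exp (y i) :=
    fun n y => Finset.prod_nonneg fun _ _ => (Real.exp_pos _).le
  have hfin : ∫⁻ y, ENNReal.ofReal (Real.exp y) ∂a.jumpLaw ≠ ∞ := by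
    have h := a.integrable_exp_jumpLaw.2
    rw [hasFiniteIntegral_iff_ofReal (Filter.Eventually.of_forall fun _ => (Real.exp_pos _).le)] at h
    exact h.ne
  have hms : ∀ n : ℕ, Measurable fun y : ℕ → ℝ => ∏ i ∈ Finset.range n, Real.exp (y i) :=
    fun n => Finset.measurable_prod _ fun i _ => by fun_prop
  rw [integrable_prod_iff measurable_jumpFactor.aestronglyMeasurable]
  constructor
  · refine Filter.Eventually.of_forall fun n => ⟨(hms n).aestronglyMeasurable, ?_⟩
    rw [hasFiniteIntegral_iff_ofReal (Filter.Eventually.of_forall (hpos n)),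
      a.lintegral_prod_exp n]
    exact ENNReal.pow_lt_top hfin.lt_top
  · set m := ∫⁻ y, ENNReal.ofReal (Real.exp y) ∂a.jumpLaw
    have hint : ∀ n : ℕ, ∫ y, ‖∏ i ∈ Finset.range n, Real.exp (y i)‖
        ∂(Measure.infinitePi fun _ : ℕ => a.jumpLaw) = m.toReal ^ n := fun n => by
      simp_rw [Real.norm_of_nonneg (hpos n _)]
      rw [integral_eq_lintegral_of_nonneg_ae (Filter.Eventually.of_forall (hpos n))
        (hms n).aestronglyMeasurable, a.lintegral_prod_exp n, ENNReal.toReal_pow]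
    simp only [hint]
    rw [integrable_poissonMeasure_iff]
    refine ((Real.summable_pow_div_factorial (r * m.toReal)).mul_left (Real.exp (-r))).congr
      fun n => ?_
    rw [Real.norm_of_nonneg (by positivity), mul_pow]
    ring

namespace Problem

variable (D : Problem)

/-! ### Growth of the two amounts over one period -/

lemma measurable_stockEnd : Measurable fun z : ℝ × Noise => D.stockEnd z.1 z.2 := by
  have h : Measurable fun z : ℝ × Noise => ∏ i ∈ Finset.range z.2.2.1.1, Real.exp (z.2.2.1.2 i) :=
    measurable_jumpFactor.comp (by fun_prop : Measurable fun z : ℝ × Noise => z.2.2.1)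
  unfold stockEnd dZs
  exact Measurable.mul (by fun_prop) h

lemma measurable_bondEnd : Measurable fun z : ℝ × Noise => D.bondEnd z.1 z.2 := by
  have h : Measurable fun z : ℝ × Noise => ∏ i ∈ Finset.range z.2.2.2.1, Real.exp (z.2.2.2.2 i) :=
    measurable_jumpFactor.comp (by fun_prop : Measurable fun z : ℝ × Noise => z.2.2.2)
  have h' : Measurable fun z : ℝ × Noise => if z.1 < 0 then D.muC else 0 :=
    Measurable.ite (measurableSet_Iio.preimage measurable_fst) (by fun_prop) (by fun_prop)
  unfold bondEnd dZb
  exact Measurable.mul (by fun_prop) h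

/-- Both amounts grow over a period at most by an integrable factor. -/
lemma exists_growth_bound : ∃ A : Noise → ℝ, Integrable A D.noiseLaw ∧ (∀ e, 0 ≤ A e) ∧
    (∀ s e, |D.stockEnd s e| ≤ |s| * A e) ∧ ∀ b e, |D.bondEnd b e| ≤ |b| * A e := by
  set v := D.dt.toNNReal
  set As : Noise → ℝ := fun e =>
    Real.exp ((D.stock.mu - D.stock.lam * D.stock.jumpMean - D.stock.sigma ^ 2 / 2) * D.dt
      + D.stock.sigma * dZs e) * ∏ i ∈ Finset.range e.2.1.1, Real.exp (e.2.1.2 i) with hAs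
  -- With `|muC|` in the drift, one factor dominates the growth for both signs of the bond amount.
  set Ab : Noise → ℝ := fun e =>
    Real.exp ((D.bond.mu - D.bond.lam * D.bond.jumpMean + |D.muC| - D.bond.sigma ^ 2 / 2) * D.dt
      + D.bond.sigma * D.dZb e) * ∏ i ∈ Finset.range e.2.2.1, Real.exp (e.2.2.2 i) with hAb
  have hdt : 0 ≤ D.dt := div_nonneg D.T_pos.le (Nat.cast_nonneg _)
  have hjump : ∀ (n : ℕ) (y : ℕ → ℝ), 0 ≤ ∏ i ∈ Finset.range n, Real.exp (y i) :=
    fun n y => Finset.prod_nonneg fun _ _ => (Real.exp_pos _).le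
  have gauss : ∀ c t u : ℝ, Integrable (fun z : ℝ × ℝ => Real.exp (c + (t * z.1 + u * z.2)))
      ((gaussianReal 0 v).prod (gaussianReal 0 v)) := fun c t u => by
    refine (((integrable_exp_mul_gaussianReal t).mul_prod
      (integrable_exp_mul_gaussianReal u)).const_mul (Real.exp c)).congr
      (Filter.Eventually.of_forall fun z => ?_)
    simp only [Real.exp_add]
  have iAs : Integrable As D.noiseLaw := by
    refine ((gauss ((D.stock.mu - D.stock.lam * D.stock.jumpMean - D.stock.sigma ^ 2 / 2) * D.dt)
      D.stock.sigma 0).mul_prod ((D.stock.integrable_jumpFactor _).comp_fst _)).congr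
      (Filter.Eventually.of_forall fun e => ?_)
    simp [hAs, dZs]
  have iAb : Integrable Ab D.noiseLaw := by
    refine ((gauss ((D.bond.mu - D.bond.lam * D.bond.jumpMean + |D.muC|
      - D.bond.sigma ^ 2 / 2) * D.dt) (D.bond.sigma * D.rho)
      (D.bond.sigma * √(1 - D.rho ^ 2))).mul_prod
      ((D.bond.integrable_jumpFactor _).comp_snd _)).congr
      (Filter.Eventually.of_forall fun e => ?_)
    simp [hAb, dZb, mul_add, mul_assoc]
  have pAs : ∀ e, 0 ≤ As e := fun e => mul_nonneg (Real.exp_pos _).le (hjump _ _)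
  have pAb : ∀ e, 0 ≤ Ab e := fun e => mul_nonneg (Real.exp_pos _).le (hjump _ _)
  refine ⟨As + Ab, iAs.add iAb, fun e => add_nonneg (pAs e) (pAb e), fun s e => ?_, fun b e => ?_⟩
  · rw [stockEnd, mul_assoc, abs_mul]
    refine mul_le_mul_of_nonneg_left ?_ (abs_nonneg _)
    rw [abs_of_nonneg (pAs e)]
    exact le_add_of_nonneg_right (pAb e)
  · rw [bondEnd, mul_assoc, abs_mul]
    refine mul_le_mul_of_nonneg_left ?_ (abs_nonneg _)
    rw [abs_of_nonneg (mul_nonneg (Real.exp_pos _).le (hjump _ _))]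
    refine le_trans ?_ (le_add_of_nonneg_left (pAs e))
    refine mul_le_mul_of_nonneg_right (Real.exp_le_exp.2 ?_) (hjump _ _)
    have : (if b < 0 then D.muC else 0) ≤ |D.muC| := by
      split_ifs
      exacts [le_abs_self _, abs_nonneg _]
    gcongr

lemma continuous_stockEnd (e : Noise) : Continuous fun s => D.stockEnd s e := by
  unfold stockEnd
  fun_prop

/-- The growth rate jumps at `b = 0`, but the prefactor `b` makes both branches vanish there. -/
lemma continuous_bondEnd (e : Noise) : Continuous fun b => D.bondEnd b e := by
  unfold bondEnd
  refine Continuous.mul ?_ continuous_const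
  have h : (fun b : ℝ => b * Real.exp ((D.bond.mu - D.bond.lam * D.bond.jumpMean
      + (if b < 0 then D.muC else 0) - D.bond.sigma ^ 2 / 2) * D.dt + D.bond.sigma * D.dZb e)) =
      fun b : ℝ => if b ≤ 0 then b * Real.exp ((D.bond.mu - D.bond.lam * D.bond.jumpMean + D.muC
        - D.bond.sigma ^ 2 / 2) * D.dt + D.bond.sigma * D.dZb e)
      else b * Real.exp ((D.bond.mu - D.bond.lam * D.bond.jumpMean + 0
        - D.bond.sigma ^ 2 / 2) * D.dt + D.bond.sigma * D.dZb e) := by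
    funext b
    rcases lt_trichotomy b 0 with hb | rfl | hb
    · simp [hb, hb.le]
    · simp
    · simp [hb.le.not_gt, hb.not_ge]
  rw [h]
  exact Continuous.if_le (by fun_prop) (by fun_prop) continuous_id continuous_const
    fun b hb => by simp [hb]

end Problem

end EWES

noncomputable section

namespace EWES

/-! ### Measurable maximizers -/

lemma bddAbove_image_Icc {f : ℝ → ℝ → ℝ} (hf : Continuous ↿f) (a b x : ℝ) :
    BddAbove (f x '' Set.Icc a b) :=
  isCompact_Icc.bddAbove_image (hf.comp (by fun_prop : Continuous fun y : ℝ => (x, y))).continuousOn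

/-- A continuous function of two variables has a maximizer in the second variable, over a compact
interval, that depends measurably on the first variable. -/
lemma exists_measurable_argmax {f : ℝ → ℝ → ℝ} (hf : Continuous ↿f) {a b : ℝ} (hab : a ≤ b) :
    ∃ φ : ℝ → ℝ, Measurable φ ∧
      ∀ x, φ x ∈ Set.Icc a b ∧ f x (φ x) = sSup (f x '' Set.Icc a b) := by
  have hfx : ∀ x, Continuous (f x) := fun x => hf.comp (by fun_prop : Continuous fun y : ℝ => (x, y))
  set m : ℝ → ℝ := fun x => sSup (f x '' Set.Icc a b) with hm
  set S : ℝ → Set ℝ := fun x => Set.Icc a b ∩ {y | f x y = m x} with hS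
  have hSc : ∀ x, IsCompact (S x) := fun x =>
    isCompact_Icc.inter_right (isClosed_eq (hfx x) continuous_const)
  have hSn : ∀ x, (S x).Nonempty := fun x => by
    obtain ⟨y, hy, h⟩ := isCompact_Icc.exists_sSup_image_eq (Set.nonempty_Icc.2 hab)
      (hfx x).continuousOn
    exact ⟨y, hy, h.symm⟩
  have hmem : ∀ x, sSup (S x) ∈ S x := fun x => (hSc x).sSup_mem (hSn x)
  -- The largest maximizer is selected. It is at least `c` iff the maximum is already attained on
  -- `[max a c, b]`, a closed condition because both suprema are continuous in `x`.
  refine ⟨fun x => sSup (S x), measurable_of_Ici fun c => ?_, fun x => hmem x⟩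
  rcases le_or_gt (max a c) b with hc | hc
  · have h : (fun x => sSup (S x)) ⁻¹' Set.Ici c =
        {x | m x ≤ sSup (f x '' Set.Icc (max a c) b)} := by
      ext x
      simp only [Set.mem_preimage, Set.mem_Ici, Set.mem_ofPred_eq]
      constructor
      · intro h
        rw [← (hmem x).2]
        exact le_csSup (bddAbove_image_Icc hf _ _ x)
          ⟨_, ⟨max_le (hmem x).1.1 h, (hmem x).1.2⟩, rfl⟩
      · intro h
        obtain ⟨y, hy, hy'⟩ := isCompact_Icc.exists_sSup_image_eq (Set.nonempty_Icc.2 hc)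
          (hfx x).continuousOn
        have hyab : y ∈ Set.Icc a b := ⟨(le_max_left _ _).trans hy.1, hy.2⟩
        refine ((le_max_right a c).trans hy.1).trans (le_csSup (hSc x).bddAbove ⟨hyab, ?_⟩)
        exact le_antisymm (le_csSup (bddAbove_image_Icc hf _ _ x) ⟨y, hyab, rfl⟩) (hy' ▸ h)
    rw [h]
    exact (isClosed_le (isCompact_Icc.continuous_sSup hf)
      (isCompact_Icc.continuous_sSup hf)).measurableSet
  · have h : (fun x => sSup (S x)) ⁻¹' Set.Ici c = ∅ := by
      ext x
      simp only [Set.mem_preimage, Set.mem_Ici, Set.mem_empty_iff_false, iff_false, not_le]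
      by_contra h
      exact (max_le (hmem x).1.1 (not_lt.1 h)).not_gt ((hmem x).1.2.trans_lt hc)
    rw [h]
    exact MeasurableSet.empty

namespace Problem

variable (D : Problem)

/-! ### The dynamic programming recursion -/

/-- The allocation of the wealth `z` with the fraction `p` of its positive part in the stock. -/
def allocate (z p : ℝ) : State := (p * max z 0, z - p * max z 0)

/-- The largest continuation value that can be reached from the wealth `z` by rebalancing. -/
def rebalanceValue (h : State → ℝ) (z : ℝ) : ℝ :=
  sSup ((fun p => h (allocate z p)) '' Set.Icc 0 1)

/-- The Bellman operator: the best withdrawal followed by the best rebalancing. -/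
def bellman (h : State → ℝ) (w : ℝ) : ℝ :=
  sSup ((fun q => q + rebalanceValue h (w - q)) '' Set.Icc D.qmin D.qmax)

/-- The value of the target problem right after the rebalancing, as a function of the
post-rebalancing state, when `k` rebalancing dates remain. -/
def continuation (c Wstar : ℝ) : ℕ → State → ℝ
  | 0 => fun x => c * min (x.1 + x.2 - Wstar) 0
  | k + 1 => fun x =>
    ∫ e, D.bellman (continuation c Wstar k) (D.stockEnd x.1 e + D.bondEnd x.2 e) ∂D.noiseLaw

/-- The loss of optimality of the decision of the control `P` at the date `t_i` in the state `x`. -/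
def gap (c Wstar : ℝ) (P : Control) (i : ℕ) (x : State) : ℝ :=
  D.bellman (D.continuation c Wstar (D.M - i)) (x.1 + x.2)
    - (P.q i x + D.continuation c Wstar (D.M - i) (stateAfter P i x))

/-- Investing a fraction of the positive part lets `p` range over the fixed interval `[0, 1]` at
every wealth, with no effect when insolvent. The constraint `Zp`, which changes abruptly at zero
wealth, is thus replaced by a continuous problem. -/
lemma continuous_allocate : Continuous ↿allocate := by
  unfold allocate Function.HasUncurry.uncurry
  simp only [Function.hasUncurryInduction]
  fun_prop

lemma continuous_rebalanceValue {h : State → ℝ} (hh : Continuous h) :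
    Continuous (rebalanceValue h) :=
  isCompact_Icc.continuous_sSup (f := fun z p => h (allocate z p)) (hh.comp continuous_allocate)

lemma continuous_withdraw {h : State → ℝ} (hh : Continuous h) :
    Continuous ↿fun w q : ℝ => q + rebalanceValue h (w - q) :=
  continuous_snd.add ((continuous_rebalanceValue hh).comp (continuous_fst.sub continuous_snd))

lemma continuous_bellman {h : State → ℝ} (hh : Continuous h) : Continuous (D.bellman h) :=
  isCompact_Icc.continuous_sSup (continuous_withdraw hh)

lemma le_bellman {h : State → ℝ} (hh : Continuous h) (w : ℝ) {q p : ℝ} (hq : q ∈ D.Zq)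
    (hp : p ∈ Set.Icc (0 : ℝ) 1) : q + h (allocate (w - q) p) ≤ D.bellman h w := by
  refine le_trans ?_ (le_csSup (bddAbove_image_Icc (continuous_withdraw hh) _ _ w) ⟨q, hq, rfl⟩)
  have := le_csSup (bddAbove_image_Icc (f := fun z p => h (allocate z p))
    (hh.comp continuous_allocate) 0 1 (w - q)) ⟨p, hp, rfl⟩
  exact (add_le_add_iff_left q).2 this

/-- The Bellman operator has measurable maximizers. -/
lemma exists_measurable_decision {h : State → ℝ} (hh : Continuous h) :
    ∃ φ ψ : ℝ → ℝ, Measurable φ ∧ Measurable ψ ∧ ∀ w, φ w ∈ D.Zq ∧ ψ w ∈ Set.Icc (0 : ℝ) 1 ∧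
      φ w + h (allocate (w - φ w) (ψ w)) = D.bellman h w := by
  obtain ⟨φ, mφ, hφ⟩ := exists_measurable_argmax (continuous_withdraw hh) D.qmin_le_qmax
  obtain ⟨ψ, mψ, hψ⟩ := exists_measurable_argmax (f := fun z p => h (allocate z p))
    (hh.comp continuous_allocate) zero_le_one
  refine ⟨φ, fun w => ψ (w - φ w), mφ, mψ.comp (measurable_id.sub mφ), fun w =>
    ⟨(hφ w).1, (hψ _).1, ?_⟩⟩
  rw [bellman, ← (hφ w).2, (hψ (w - φ w)).2, rebalanceValue]

/-- At most linear growth of a function of the state. -/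
def LinearGrowth (h : State → ℝ) : Prop := ∃ C, 0 ≤ C ∧ ∀ x, |h x| ≤ C * (1 + |x.1| + |x.2|)

lemma abs_allocate_le {z p : ℝ} (hp : p ∈ Set.Icc (0 : ℝ) 1) :
    |(allocate z p).1| + |(allocate z p).2| ≤ |z| := by
  obtain ⟨h0, h1⟩ := hp
  unfold allocate
  rcases le_total z 0 with hz | hz
  · simp [max_eq_right hz]
  · simp only [max_eq_left hz]
    rw [abs_of_nonneg (mul_nonneg h0 hz), abs_of_nonneg (by nlinarith), abs_of_nonneg hz]
    linarith

lemma exists_abs_q_le : ∃ Q, 0 ≤ Q ∧ ∀ q ∈ D.Zq, |q| ≤ Q :=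
  ⟨max |D.qmin| |D.qmax|, le_max_of_le_left (abs_nonneg _), fun _ hq => abs_le_max_abs_abs hq.1 hq.2⟩

lemma exists_abs_bellman_le {h : State → ℝ} (hh : Continuous h) (hl : LinearGrowth h) :
    ∃ C, 0 ≤ C ∧ ∀ w, |D.bellman h w| ≤ C * (1 + |w|) := by
  obtain ⟨C, hC, hb⟩ := hl
  obtain ⟨Q, hQ, hq⟩ := D.exists_abs_q_le
  obtain ⟨φ, ψ, -, -, hs⟩ := D.exists_measurable_decision hh
  -- At the maximizer the value is at most `Q + C (1 + |w| + Q)`.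
  refine ⟨Q + C + C * Q, by positivity, fun w => ?_⟩
  obtain ⟨h1, h2, h3⟩ := hs w
  have h4 := hb (allocate (w - φ w) (ψ w))
  have h5 := abs_allocate_le (z := w - φ w) h2
  have h6 := abs_sub w (φ w)
  have h7 := hq _ h1
  have h8 : C * (1 + |(allocate (w - φ w) (ψ w)).1| + |(allocate (w - φ w) (ψ w)).2|)
      ≤ C * (1 + |w| + Q) := mul_le_mul_of_nonneg_left (by linarith) hC
  rw [← h3]
  refine (abs_add_le _ _).trans ?_
  have := abs_nonneg w
  nlinarith [mul_nonneg hQ this, mul_nonneg (mul_nonneg hC hQ) this]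

lemma continuous_and_linearGrowth_expectation {V : ℝ → ℝ} (hV : Continuous V) {C : ℝ} (hC : 0 ≤ C)
    (hb : ∀ w, |V w| ≤ C * (1 + |w|)) :
    (Continuous fun x : State => ∫ e, V (D.stockEnd x.1 e + D.bondEnd x.2 e) ∂D.noiseLaw) ∧
      LinearGrowth fun x => ∫ e, V (D.stockEnd x.1 e + D.bondEnd x.2 e) ∂D.noiseLaw := by
  obtain ⟨A, iA, pA, hs, hbd⟩ := D.exists_growth_bound
  have bound : ∀ (x : State) e, ‖V (D.stockEnd x.1 e + D.bondEnd x.2 e)‖ ≤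
      C * (1 + (|x.1| + |x.2|) * A e) := fun x e => by
    refine (hb _).trans (mul_le_mul_of_nonneg_left ?_ hC)
    linarith [abs_add_le (D.stockEnd x.1 e) (D.bondEnd x.2 e), hs x.1 e, hbd x.2 e]
  have iB : ∀ r : ℝ, Integrable (fun e => C * (1 + r * A e)) D.noiseLaw := fun r =>
    ((integrable_const 1).add (iA.const_mul r)).const_mul C
  constructor
  · rw [continuous_iff_continuousAt]
    intro x
    -- The extra `1` makes the bound uniform over a neighbourhood of `x`.
    refine continuousAt_of_dominated (bound := fun e => C * (1 + (|x.1| + |x.2| + 1) * A e))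
      (Filter.Eventually.of_forall fun y => ?_) ?_ (iB _) (Filter.Eventually.of_forall fun e => ?_)
    · refine (hV.measurable.comp (Measurable.add ?_ ?_)).aestronglyMeasurable
      · exact D.measurable_stockEnd.comp (by fun_prop : Measurable fun e : Noise => (y.1, e))
      · exact D.measurable_bondEnd.comp (by fun_prop : Measurable fun e : Noise => (y.2, e))
    · have hc : Continuous fun y : State => |y.1| + |y.2| := by fun_prop
      filter_upwards [hc.continuousAt.eventually_lt_const (lt_add_one (|x.1| + |x.2|))] with y hy
      refine Filter.Eventually.of_forall fun e => (bound y e).trans ?_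
      have := pA e
      gcongr
    · exact (hV.comp (((D.continuous_stockEnd e).comp continuous_fst).add
        ((D.continuous_bondEnd e).comp continuous_snd))).continuousAt
  · have hm : 0 ≤ ∫ e, A e ∂D.noiseLaw := integral_nonneg pA
    refine ⟨C * (1 + ∫ e, A e ∂D.noiseLaw), by positivity, fun x => ?_⟩
    have h := norm_integral_le_of_norm_le (iB (|x.1| + |x.2|))
      (Filter.Eventually.of_forall (bound x))
    rw [integral_const_mul, integral_add (integrable_const 1) (iA.const_mul _),
      integral_const_mul] at h
    simp only [integral_const, probReal_univ, smul_eq_mul, mul_one, Real.norm_eq_abs] at h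
    refine h.trans ?_
    rw [mul_assoc]
    refine mul_le_mul_of_nonneg_left ?_ hC
    nlinarith [abs_nonneg x.1, abs_nonneg x.2]

lemma continuous_and_linearGrowth_continuation (c Wstar : ℝ) (k : ℕ) :
    Continuous (D.continuation c Wstar k) ∧ LinearGrowth (D.continuation c Wstar k) := by
  induction k with
  | zero =>
    refine ⟨by unfold continuation; fun_prop, |c| * (1 + |Wstar|), by positivity, fun x => ?_⟩
    have h : |min (x.1 + x.2 - Wstar) 0| ≤ |x.1 + x.2 - Wstar| := by
      rcases le_total (x.1 + x.2 - Wstar) 0 with h | h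
      · rw [min_eq_left h]
      · simp [min_eq_right h]
    rw [continuation, abs_mul, mul_assoc]
    refine mul_le_mul_of_nonneg_left (h.trans ?_) (abs_nonneg _)
    nlinarith [abs_sub (x.1 + x.2) Wstar, abs_add_le x.1 x.2, abs_nonneg x.1, abs_nonneg x.2,
      abs_nonneg Wstar, mul_nonneg (abs_nonneg Wstar) (abs_nonneg x.1),
      mul_nonneg (abs_nonneg Wstar) (abs_nonneg x.2)]
  | succ k ih =>
    obtain ⟨C, hC, hb⟩ := D.exists_abs_bellman_le ih.1 ih.2
    exact D.continuous_and_linearGrowth_expectation (D.continuous_bellman ih.1) hC hb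

/-- If solvent before `t_M`, the positive part is the wealth itself; otherwise `p = 0` is forced. So
admissible decisions are feasible for the Bellman operator. -/
lemma stateAfter_eq_allocate {P : Control} {n i : ℕ} (hP : P ∈ D.admissible n) (hn : n ≤ i)
    (hi : i ≤ D.M) (x : State) :
    stateAfter P i x = allocate (x.1 + x.2 - P.q i x) (P.p i x) ∧
      P.p i x ∈ Set.Icc (0 : ℝ) 1 := by
  have hp := ((hP i hn hi).2.2 x).2
  unfold Zp at hp
  unfold stateAfter allocate wealthAfter at *
  split_ifs at hp with h
  · refine ⟨?_, hp⟩
    rw [max_eq_left h.2.le]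
    ext <;> simp
    ring
  · rw [Set.mem_singleton_iff.1 hp]
    simp

lemma gap_nonneg (c Wstar : ℝ) {P : Control} {n i : ℕ} (hP : P ∈ D.admissible n) (hn : n ≤ i)
    (hi : i ≤ D.M) (x : State) : 0 ≤ D.gap c Wstar P i x := by
  obtain ⟨h1, h2⟩ := D.stateAfter_eq_allocate hP hn hi x
  rw [gap, h1, sub_nonneg]
  exact D.le_bellman (D.continuous_and_linearGrowth_continuation c Wstar _).1 _
    ((hP i hn hi).2.2 x).1 h2

lemma measurable_stateAfter {P : Control} {i : ℕ} (hq : Measurable (P.q i))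
    (hp : Measurable (P.p i)) : Measurable (stateAfter P i) := by
  unfold stateAfter wealthAfter
  fun_prop

lemma measurable_gap (c Wstar : ℝ) {P : Control} {i : ℕ} (hq : Measurable (P.q i))
    (hp : Measurable (P.p i)) : Measurable (D.gap c Wstar P i) := by
  have hk := (D.continuous_and_linearGrowth_continuation c Wstar (D.M - i)).1
  exact ((D.continuous_bellman hk).measurable.comp (by fun_prop)).sub
    (hq.add (hk.measurable.comp (measurable_stateAfter hq hp)))

/-- The dynamic programming recursion gives an admissible control without loss of optimality. -/
lemma exists_gap_eq_zero (c Wstar : ℝ) :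
    ∃ P ∈ D.admissible 0, ∀ i ≤ D.M, ∀ x, D.gap c Wstar P i x = 0 := by
  classical
  choose φ ψ mφ mψ hs using fun i : ℕ => D.exists_measurable_decision
    (D.continuous_and_linearGrowth_continuation c Wstar (D.M - i)).1
  -- Setting the fraction to zero when insolvent or at `t_M` restores admissibility at no loss:
  -- `allocate` ignores `p` at nonpositive wealth, and the terminal payoff depends only on total
  -- wealth.
  refine ⟨⟨fun i x => φ i (x.1 + x.2), fun i x =>
    if i ≠ D.M ∧ 0 < x.1 + x.2 - φ i (x.1 + x.2) then ψ i (x.1 + x.2) else 0⟩,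
    fun i _ _ => ⟨?_, ?_, fun x => ⟨(hs i _).1, ?_⟩⟩, fun i _ x => ?_⟩
  · exact (mφ i).comp (by fun_prop)
  · have hm : Measurable fun x : State => x.1 + x.2 := by fun_prop
    exact Measurable.ite ((MeasurableSet.const _).inter (measurableSet_lt measurable_const
      (hm.sub ((mφ i).comp hm)))) ((mψ i).comp hm) measurable_const
  · change (if _ then _ else _) ∈ D.Zp (x.1 + x.2 - φ i (x.1 + x.2)) i
    by_cases h : i ≠ D.M ∧ 0 < x.1 + x.2 - φ i (x.1 + x.2)
    · rw [if_pos h, show D.Zp _ i = Set.Icc 0 1 from if_pos h]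
      exact (hs i _).2.1
    · rw [if_neg h, show D.Zp _ i = {0} from if_neg h]
      rfl
  · rw [gap, sub_eq_zero, ← (hs i (x.1 + x.2)).2.2]
    congr 1
    simp only [stateAfter, wealthAfter, allocate]
    split_ifs with h
    · rw [max_eq_left h.2.le]
      congr 2
      ring
    · rw [not_and_or, not_not] at h
      rcases h with rfl | h
      · simp [continuation]
      · simp [max_eq_right (not_lt.1 h)]

end Problem

end EWES

namespace EWES

/-! ### Splicing paths -/

/-- The path that follows `ω` before the date `t_n` and `ω'` from `t_n` on. -/
def splice (n : ℕ) (ω ω' : Path) : Path := fun i => if i < n then ω i else ω' i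

namespace Problem

variable (D : Problem)

/-- Independence of the periods: splicing two independent paths gives a path with the same law. -/
lemma measurePreserving_splice (n : ℕ) :
    MeasurePreserving (fun z : Path × Path => splice n z.1 z.2) (D.pathLaw.prod D.pathLaw)
      D.pathLaw := by
  have hm : Measurable fun z : Path × Path => splice n z.1 z.2 := by
    refine measurable_pi_lambda _ fun i => ?_
    unfold splice
    split_ifs <;> fun_prop
  refine ⟨hm, Measure.eq_infinitePi _ fun s t ht => ?_⟩
  rw [Measure.map_apply hm (MeasurableSet.pi s.countable_toSet fun i _ => ht i)]
  -- The preimage of a cylinder is a product of two cylinders, on the indices before `n` and from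
  -- `n` on.
  have h : (fun z : Path × Path => splice n z.1 z.2) ⁻¹' Set.pi s t =
      Set.pi (s.filter (· < n) : Finset ℕ) t ×ˢ Set.pi (s.filter (¬ · < n) : Finset ℕ) t := by
    ext z
    simp only [Set.mem_preimage, Set.mem_pi, Set.mem_prod, Finset.coe_filter, Set.mem_ofPred_eq,
      splice, Finset.mem_coe]
    constructor
    · intro hz
      exact ⟨fun i hi => by simpa [hi.2] using hz i hi.1,
        fun i hi => by simpa [hi.2] using hz i hi.1⟩
    · rintro ⟨h1, h2⟩ i hi
      split_ifs with hin
      exacts [h1 i ⟨hi, hin⟩, h2 i ⟨hi, hin⟩]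
  rw [h, Measure.prod_prod, pathLaw, Measure.infinitePi_pi _ fun i _ => ht i,
    Measure.infinitePi_pi _ fun i _ => ht i, Finset.prod_filter_mul_prod_filter_not]

/-- The state at the end of a period that starts in the state `y`. -/
def stateEnd (y : State) (e : Noise) : State := (D.stockEnd y.1 e, D.bondEnd y.2 e)

lemma measurable_stateEnd : Measurable fun z : State × Noise => D.stateEnd z.1 z.2 :=
  (D.measurable_stockEnd.comp (by fun_prop : Measurable fun z : State × Noise => (z.1.1, z.2))).prodMk
    (D.measurable_bondEnd.comp (by fun_prop : Measurable fun z : State × Noise => (z.1.2, z.2)))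

/-! ### The controlled state: flow, integrability and Markov property -/

variable (P : Control) (n : ℕ) (x : State)

lemma stateBefore_self (ω : Path) : D.stateBefore P n x ω n = x := by
  cases n with
  | zero => rfl
  | succ k => simp [stateBefore]

lemma stateBefore_succ (ω : Path) {i : ℕ} (hi : n ≤ i) :
    D.stateBefore P n x ω (i + 1) =
      D.stateEnd (stateAfter P i (D.stateBefore P n x ω i)) (ω i) := by
  simp [stateBefore, stateEnd, not_lt.2 hi]

lemma stateBefore_congr {ω ω' : Path} {i : ℕ} (h : ∀ j < i, ω j = ω' j) :
    D.stateBefore P n x ω i = D.stateBefore P n x ω' i := by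
  induction i with
  | zero => rfl
  | succ i ih =>
    simp only [stateBefore, ih fun j hj => h j (hj.trans i.lt_succ_self), h i i.lt_succ_self]

/-- After splicing at `i`, the state at `t_i` and the noise of the next period live on different
factors of the product space. -/
lemma stateBefore_succ_splice (ω ω' : Path) {i : ℕ} (hi : n ≤ i) :
    D.stateBefore P n x (splice i ω ω') (i + 1) =
      D.stateEnd (stateAfter P i (D.stateBefore P n x ω i)) (ω' i) := by
  rw [D.stateBefore_succ P n x _ hi,
    D.stateBefore_congr P n x (ω' := ω) fun j hj => by simp [splice, hj]]
  simp [splice]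

/-- The flow property of the controlled state. -/
lemma stateBefore_stateBefore (ω ω' : Path) {m : ℕ} (hm : n ≤ m) :
    D.stateBefore P n (D.stateBefore P 0 x ω n) ω' m =
      D.stateBefore P 0 x (splice n ω ω') m := by
  induction m, hm using Nat.le_induction with
  | base =>
    rw [stateBefore_self]
    exact D.stateBefore_congr P 0 x fun j hj => by simp [splice, hj]
  | succ m hm ih =>
    rw [D.stateBefore_succ P n _ _ hm, ih, D.stateBefore_succ P 0 _ _ m.zero_le]
    simp [splice, not_lt.2 hm]

variable {P n}

lemma measurable_stateBefore (hP : P ∈ D.admissible n) {i : ℕ} (hn : n ≤ i) (hi : i ≤ D.M) :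
    Measurable fun ω => D.stateBefore P n x ω i := by
  induction i, hn using Nat.le_induction with
  | base => simp only [stateBefore_self, measurable_const]
  | succ i hn ih =>
    have hi' : i ≤ D.M := (Nat.le_succ i).trans hi
    simp only [D.stateBefore_succ P n x _ hn]
    exact D.measurable_stateEnd.comp (((measurable_stateAfter (hP i hn hi').1
      (hP i hn hi').2.1).comp (ih hi')).prodMk (measurable_pi_apply i))

lemma exists_stateAfter_le : ∃ Q, 0 ≤ Q ∧ ∀ {P : Control} {n : ℕ}, P ∈ D.admissible n →
    ∀ i, n ≤ i → i ≤ D.M → ∀ x : State, |P.q i x| ≤ Q ∧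
      |(stateAfter P i x).1| + |(stateAfter P i x).2| ≤ |x.1| + |x.2| + Q := by
  obtain ⟨Q, hQ, hq⟩ := D.exists_abs_q_le
  refine ⟨Q, hQ, fun {P n} hP i hn hi x => ?_⟩
  obtain ⟨h1, h2⟩ := D.stateAfter_eq_allocate hP hn hi x
  have h3 := hq _ ((hP i hn hi).2.2 x).1
  refine ⟨h3, ?_⟩
  rw [h1]
  refine (abs_allocate_le h2).trans ((abs_sub _ _).trans ?_)
  linarith [abs_add_le x.1 x.2]

lemma integrable_abs_stateBefore (hP : P ∈ D.admissible n) {i : ℕ} (hn : n ≤ i) (hi : i ≤ D.M) :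
    Integrable (fun ω => |(D.stateBefore P n x ω i).1| + |(D.stateBefore P n x ω i).2|)
      D.pathLaw := by
  induction i, hn using Nat.le_induction with
  | base => simp only [stateBefore_self, integrable_const]
  | succ i hn ih =>
    have hi' : i ≤ D.M := (Nat.le_succ i).trans hi
    obtain ⟨A, iA, pA, hs, hb⟩ := D.exists_growth_bound
    obtain ⟨Q, hQ, hq⟩ := D.exists_stateAfter_le
    have hX := D.measurable_stateBefore x hP (hn.trans i.le_succ) hi
    have hm : Measurable fun ω => |(D.stateBefore P n x ω (i + 1)).1| +
        |(D.stateBefore P n x ω (i + 1)).2| := by fun_prop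
    rw [← (D.measurePreserving_splice i).integrable_comp hm.aestronglyMeasurable]
    have iA' : Integrable (fun ω : Path => A (ω i)) D.pathLaw :=
      (measurePreserving_eval_infinitePi (fun _ : ℕ => D.noiseLaw) i).integrable_comp_of_integrable
        iA
    -- The bound is a product of a function of the first path and one of the second, hence
    -- integrable on the product.
    refine ((((ih hi').add (integrable_const Q)).mul_prod iA').const_mul 2).mono'
      (hm.comp (D.measurePreserving_splice i).measurable).aestronglyMeasurable
      (Filter.Eventually.of_forall fun z => ?_)
    simp only [Function.comp_apply, D.stateBefore_succ_splice P n x _ _ hn, stateEnd, Pi.add_apply]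
    rw [Real.norm_of_nonneg (by positivity)]
    have h := (hq hP i hn hi' (D.stateBefore P n x z.1 i)).2
    set y := stateAfter P i (D.stateBefore P n x z.1 i)
    nlinarith [hs y.1 (z.2 i), hb y.2 (z.2 i), mul_le_mul_of_nonneg_right h (pA (z.2 i)),
      mul_nonneg (abs_nonneg y.1) (pA (z.2 i)), mul_nonneg (abs_nonneg y.2) (pA (z.2 i))]

lemma integrable_comp_stateBefore (hP : P ∈ D.admissible n) {i : ℕ} (hn : n ≤ i) (hi : i ≤ D.M)
    {g : State → ℝ} (hg : Measurable g) (hl : LinearGrowth g) :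
    Integrable (fun ω => g (D.stateBefore P n x ω i)) D.pathLaw := by
  obtain ⟨C, hC, hb⟩ := hl
  refine (((integrable_const 1).add (D.integrable_abs_stateBefore x hP hn hi)).const_mul C).mono'
    (hg.comp (D.measurable_stateBefore x hP hn hi)).aestronglyMeasurable
    (Filter.Eventually.of_forall fun ω => (hb _).trans_eq ?_)
  simp only [Pi.add_apply, add_assoc]

/-- The Markov property of the controlled state over one period. -/
lemma integral_comp_stateBefore_succ (hP : P ∈ D.admissible n) {i : ℕ} (hn : n ≤ i)
    (hi : i + 1 ≤ D.M) {g : State → ℝ} (hg : Measurable g) (hl : LinearGrowth g) :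
    ∫ ω, g (D.stateBefore P n x ω (i + 1)) ∂D.pathLaw =
      ∫ ω, ∫ e, g (D.stateEnd (stateAfter P i (D.stateBefore P n x ω i)) e)
        ∂D.noiseLaw ∂D.pathLaw := by
  have hsp := D.measurePreserving_splice i
  have hint := D.integrable_comp_stateBefore x hP (hn.trans i.le_succ) hi hg hl
  have hX : Measurable fun ω => g (D.stateBefore P n x ω (i + 1)) :=
    hg.comp (D.measurable_stateBefore x hP (hn.trans i.le_succ) hi)
  have hint' := hsp.integrable_comp_of_integrable hint
  nth_rewrite 1 [← hsp.map_eq]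
  rw [integral_map hsp.aemeasurable hX.aestronglyMeasurable]
  simp only [Function.comp_def] at hint'
  rw [integral_prod _ hint']
  refine integral_congr_ae (Filter.Eventually.of_forall fun ω => ?_)
  simp only [D.stateBefore_succ_splice P n x _ _ hn]
  have hev := measurePreserving_eval_infinitePi (fun _ : ℕ => D.noiseLaw) i
  have hme : Measurable fun e => g (D.stateEnd (stateAfter P i (D.stateBefore P n x ω i)) e) :=
    hg.comp (D.measurable_stateEnd.comp measurable_prodMk_left)
  conv_rhs => rw [← hev.map_eq]
  rw [integral_map hev.aemeasurable hme.aestronglyMeasurable]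
  rfl

end Problem

end EWES

namespace EWES

namespace Problem

variable (D : Problem)

/-! ### Optimality as absence of gaps -/

section

variable {P : Control} {n : ℕ} (c Wstar : ℝ) (x : State)

lemma linearGrowth_bellman (i : ℕ) :
    LinearGrowth fun y => D.bellman (D.continuation c Wstar i) (y.1 + y.2) := by
  obtain ⟨h1, h2⟩ := D.continuous_and_linearGrowth_continuation c Wstar i
  obtain ⟨C, hC, hb⟩ := D.exists_abs_bellman_le h1 h2
  refine ⟨C, hC, fun y => (hb _).trans (mul_le_mul_of_nonneg_left ?_ hC)⟩
  linarith [abs_add_le y.1 y.2]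

lemma measurable_bellman (i : ℕ) :
    Measurable fun y : State => D.bellman (D.continuation c Wstar i) (y.1 + y.2) :=
  (D.continuous_bellman (D.continuous_and_linearGrowth_continuation c Wstar i).1).measurable.comp
    (by fun_prop)

lemma integrable_bellman (hP : P ∈ D.admissible n) {i : ℕ} (hn : n ≤ i) (hi : i ≤ D.M) (k : ℕ) :
    Integrable (fun ω => D.bellman (D.continuation c Wstar k)
      ((D.stateBefore P n x ω i).1 + (D.stateBefore P n x ω i).2)) D.pathLaw :=
  D.integrable_comp_stateBefore x hP hn hi (D.measurable_bellman c Wstar k)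
    (D.linearGrowth_bellman c Wstar k)

lemma integrable_q (hP : P ∈ D.admissible n) {i : ℕ} (hn : n ≤ i) (hi : i ≤ D.M) :
    Integrable (fun ω => P.q i (D.stateBefore P n x ω i)) D.pathLaw := by
  obtain ⟨Q, hQ, hq⟩ := D.exists_abs_q_le
  refine D.integrable_comp_stateBefore x hP hn hi (hP i hn hi).1 ⟨Q, hQ, fun y => ?_⟩
  have := hq _ ((hP i hn hi).2.2 y).1
  nlinarith [mul_nonneg hQ (abs_nonneg y.1), mul_nonneg hQ (abs_nonneg y.2)]

lemma integrable_continuation (hP : P ∈ D.admissible n) {i : ℕ} (hn : n ≤ i) (hi : i ≤ D.M)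
    (k : ℕ) :
    Integrable (fun ω => D.continuation c Wstar k (stateAfter P i (D.stateBefore P n x ω i)))
      D.pathLaw := by
  obtain ⟨hc, C, hC, hb⟩ := D.continuous_and_linearGrowth_continuation c Wstar k
  obtain ⟨Q, hQ, hq⟩ := D.exists_stateAfter_le
  refine D.integrable_comp_stateBefore x hP hn hi
    (g := fun y => D.continuation c Wstar k (stateAfter P i y))
    (hc.measurable.comp (measurable_stateAfter (hP i hn hi).1 (hP i hn hi).2.1))
    ⟨C * (1 + Q), by positivity, fun y => (hb _).trans ?_⟩
  have h := (hq hP i hn hi y).2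
  rw [mul_assoc]
  refine mul_le_mul_of_nonneg_left ?_ hC
  nlinarith [mul_nonneg hQ (abs_nonneg y.1), mul_nonneg hQ (abs_nonneg y.2)]

lemma integrable_gap (hP : P ∈ D.admissible n) {i : ℕ} (hn : n ≤ i) (hi : i ≤ D.M) :
    Integrable (fun ω => D.gap c Wstar P i (D.stateBefore P n x ω i)) D.pathLaw :=
  (D.integrable_bellman c Wstar x hP hn hi _).sub
    ((D.integrable_q x hP hn hi).add (D.integrable_continuation c Wstar x hP hn hi _))

lemma continuation_stateAfter_last (P : Control) (y : State) :
    D.continuation c Wstar 0 (stateAfter P D.M y) = c * min (wealthAfter P D.M y - Wstar) 0 := by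
  simp only [continuation, stateAfter]
  congr 3
  ring

lemma integrable_shortfall (hP : P ∈ D.admissible n) (hn : n ≤ D.M) :
    Integrable (fun ω => c * min (D.terminalWealth P n x ω - Wstar) 0) D.pathLaw := by
  simpa only [continuation_stateAfter_last, terminalWealth] using
    D.integrable_continuation c Wstar x hP hn le_rfl 0

lemma integrable_withdrawals (hP : P ∈ D.admissible n) :
    Integrable (fun ω => D.withdrawals P n x ω) D.pathLaw :=
  integrable_finsetSum _ fun _ hi =>
    D.integrable_q x hP (Finset.mem_Icc.1 hi).1 (Finset.mem_Icc.1 hi).2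

/-- The expected value of the state at `t_i`. -/
def expectedValue (c Wstar : ℝ) (P : Control) (n : ℕ) (x : State) (i : ℕ) : ℝ :=
  ∫ ω, D.bellman (D.continuation c Wstar (D.M - i))
    ((D.stateBefore P n x ω i).1 + (D.stateBefore P n x ω i).2) ∂D.pathLaw

lemma integral_gap_add_integral_q (hP : P ∈ D.admissible n) {i : ℕ} (hn : n ≤ i) (hi : i ≤ D.M) :
    ∫ ω, D.gap c Wstar P i (D.stateBefore P n x ω i) ∂D.pathLaw
        + ∫ ω, P.q i (D.stateBefore P n x ω i) ∂D.pathLaw =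
      D.expectedValue c Wstar P n x i - ∫ ω, D.continuation c Wstar (D.M - i)
        (stateAfter P i (D.stateBefore P n x ω i)) ∂D.pathLaw := by
  have h1 := D.integrable_bellman c Wstar x hP hn hi (D.M - i)
  have h2 := D.integrable_q x hP hn hi
  have h3 := D.integrable_continuation c Wstar x hP hn hi (D.M - i)
  simp only [gap, expectedValue]
  rw [integral_sub h1 (by exact h2.add h3), integral_add h2 h3]
  ring

/-- The continuation value is by definition the conditional mean of the next Bellman value, so the
Markov property gives the link that telescopes. -/
lemma integral_continuation (hP : P ∈ D.admissible n) {i : ℕ} (hn : n ≤ i) (hi : i < D.M) :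
    ∫ ω, D.continuation c Wstar (D.M - i) (stateAfter P i (D.stateBefore P n x ω i)) ∂D.pathLaw =
      D.expectedValue c Wstar P n x (i + 1) := by
  rw [expectedValue, D.integral_comp_stateBefore_succ x hP hn hi (D.measurable_bellman c Wstar _)
    (D.linearGrowth_bellman c Wstar _), show D.M - i = D.M - (i + 1) + 1 by omega]
  rfl

/-- The performance of a control falls short of the dynamic programming value by the expected
gaps along its trajectory. -/
lemma bellman_sub_tceqObjective (hP : P ∈ D.admissible n) (hn : n ≤ D.M) :
    D.bellman (D.continuation c Wstar (D.M - n)) (x.1 + x.2) - D.tceqObjective c Wstar P n x =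
      ∑ i ∈ Finset.Icc n D.M, ∫ ω, D.gap c Wstar P i (D.stateBefore P n x ω i) ∂D.pathLaw := by
  have h : ∀ k, n ≤ k → k ≤ D.M → ∑ i ∈ Finset.Ico n k,
      (∫ ω, D.gap c Wstar P i (D.stateBefore P n x ω i) ∂D.pathLaw
        + ∫ ω, P.q i (D.stateBefore P n x ω i) ∂D.pathLaw) =
      D.expectedValue c Wstar P n x n - D.expectedValue c Wstar P n x k := by
    intro k hk
    induction k, hk using Nat.le_induction with
    | base => simp
    | succ k hk ih =>
      intro hkM
      rw [Finset.sum_Ico_succ_top hk, ih (by omega),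
        D.integral_gap_add_integral_q c Wstar x hP hk (by omega),
        D.integral_continuation c Wstar x hP hk hkM]
      ring
  have hM := h D.M hn le_rfl
  -- The date `t_M` is treated apart: its continuation value is the terminal shortfall term rather
  -- than a next expected value.
  have hlast := D.integral_gap_add_integral_q c Wstar x hP hn le_rfl
  rw [Nat.sub_self] at hlast
  simp only [continuation_stateAfter_last] at hlast
  have hstart : D.expectedValue c Wstar P n x n =
      D.bellman (D.continuation c Wstar (D.M - n)) (x.1 + x.2) := by
    simp [expectedValue, stateBefore_self]
  rw [tceqObjective, integral_add (D.integrable_withdrawals x hP)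
    (D.integrable_shortfall c Wstar x hP hn)]
  simp only [withdrawals]
  rw [integral_finsetSum _ fun i hi => D.integrable_q x hP (Finset.mem_Icc.1 hi).1
    (Finset.mem_Icc.1 hi).2, ← Finset.Ico_add_one_right_eq_Icc, Finset.sum_Ico_succ_top hn,
    Finset.sum_Ico_succ_top hn]
  rw [Finset.sum_add_distrib] at hM
  simp only [terminalWealth]
  linarith

lemma tceqObjective_le (hP : P ∈ D.admissible n) (hn : n ≤ D.M) :
    D.tceqObjective c Wstar P n x ≤
      D.bellman (D.continuation c Wstar (D.M - n)) (x.1 + x.2) := by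
  rw [← sub_nonneg, D.bellman_sub_tceqObjective c Wstar x hP hn]
  exact Finset.sum_nonneg fun i hi => integral_nonneg fun ω =>
    D.gap_nonneg c Wstar hP (Finset.mem_Icc.1 hi).1 (Finset.mem_Icc.1 hi).2 _

/-- The control attains the dynamic programming value if and only if its gaps vanish almost surely
along its trajectory. -/
lemma tceqObjective_eq_iff (hP : P ∈ D.admissible n) (hn : n ≤ D.M) :
    D.tceqObjective c Wstar P n x = D.bellman (D.continuation c Wstar (D.M - n)) (x.1 + x.2) ↔
      ∀ i, n ≤ i → i ≤ D.M → ∀ᵐ ω ∂D.pathLaw, D.gap c Wstar P i (D.stateBefore P n x ω i) = 0 := by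
  have hnn : ∀ i ∈ Finset.Icc n D.M, ∀ ω, 0 ≤ D.gap c Wstar P i (D.stateBefore P n x ω i) :=
    fun i hi ω => D.gap_nonneg c Wstar hP (Finset.mem_Icc.1 hi).1 (Finset.mem_Icc.1 hi).2 _
  rw [eq_comm, ← sub_eq_zero, D.bellman_sub_tceqObjective c Wstar x hP hn,
    Finset.sum_eq_zero_iff_of_nonneg fun i hi => integral_nonneg (hnn i hi)]
  simp only [Finset.mem_Icc, and_imp]
  refine forall₃_congr fun i h1 h2 => ?_
  rw [integral_eq_zero_iff_of_nonneg (hnn i (Finset.mem_Icc.2 ⟨h1, h2⟩))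
    (D.integrable_gap c Wstar x hP h1 h2)]
  rfl

lemma admissible_mono {n m : ℕ} (h : n ≤ m) : D.admissible n ⊆ D.admissible m :=
  fun _ hP i hi hi' => hP i (h.trans hi) hi'

/-- The value function of the target problem is the dynamic programming value. -/
lemma tceqValue_eq (hn : n ≤ D.M) :
    D.tceqValue c Wstar n x = D.bellman (D.continuation c Wstar (D.M - n)) (x.1 + x.2) := by
  refine le_antisymm (iSup₂_le fun P hP =>
    EReal.coe_le_coe_iff.2 (D.tceqObjective_le c Wstar x hP hn)) ?_
  obtain ⟨P, hP, h0⟩ := D.exists_gap_eq_zero c Wstar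
  have hP' := D.admissible_mono n.zero_le hP
  rw [← (D.tceqObjective_eq_iff c Wstar x hP' hn).2 fun i _ hi =>
    Filter.Eventually.of_forall fun ω => h0 i hi _]
  exact le_iSup₂_of_le P hP' le_rfl

lemma isTceqOptimalAt_iff (hP : P ∈ D.admissible n) (hn : n ≤ D.M) :
    D.IsTceqOptimalAt c Wstar P n x ↔
      ∀ i, n ≤ i → i ≤ D.M → ∀ᵐ ω ∂D.pathLaw, D.gap c Wstar P i (D.stateBefore P n x ω i) = 0 := by
  rw [IsTceqOptimalAt, D.tceqValue_eq c Wstar x hn, EReal.coe_eq_coe_iff,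
    D.tceqObjective_eq_iff c Wstar x hP hn, and_iff_right hP]

/-- Bellman's principle: the tails of an optimal control are almost surely optimal along its
trajectory. -/
lemma isTceqOptimalAt_zero_iff_forall_tail (hP : P ∈ D.admissible 0) :
    D.IsTceqOptimalAt c Wstar P 0 x ↔
      ∀ n ≤ D.M, ∀ᵐ ω ∂D.pathLaw, D.IsTceqOptimalAt c Wstar P n (D.stateBefore P 0 x ω n) := by
  constructor
  · intro h n hn
    rw [D.isTceqOptimalAt_iff c Wstar x hP (Nat.zero_le _)] at h
    have hP' := D.admissible_mono n.zero_le hP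
    have key : ∀ i, n ≤ i → i ≤ D.M → ∀ᵐ ω ∂D.pathLaw, ∀ᵐ ω' ∂D.pathLaw,
        D.gap c Wstar P i (D.stateBefore P n (D.stateBefore P 0 x ω n) ω' i) = 0 := by
      intro i hni hi
      -- By the flow property, the restarted trajectory is that of a spliced path, which has the law
      -- `pathLaw`; Fubini then separates past from future.
      simp only [D.stateBefore_stateBefore P n x _ _ hni]
      exact Measure.ae_ae_of_ae_prod
        ((D.measurePreserving_splice n).quasiMeasurePreserving.ae (h i i.zero_le hi))
    have key' : ∀ᵐ ω ∂D.pathLaw, ∀ i, n ≤ i → i ≤ D.M → ∀ᵐ ω' ∂D.pathLaw,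
        D.gap c Wstar P i (D.stateBefore P n (D.stateBefore P 0 x ω n) ω' i) = 0 := by
      simp only [ae_all_iff]
      exact key
    filter_upwards [key'] with ω hω
    exact (D.isTceqOptimalAt_iff c Wstar _ hP' hn).2 hω
  · intro h
    obtain ⟨ω, hω⟩ := (h 0 (Nat.zero_le _)).exists
    rwa [stateBefore_self] at hω

/-- A time consistent optimal control has no gap in any state. -/
lemma IsTceqTimeConsistent.gap_eq_zero {D : Problem} {c Wstar : ℝ} {P : Control}
    (h : D.IsTceqTimeConsistent c Wstar P) {n : ℕ} (hn : n ≤ D.M) (x : State) :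
    D.gap c Wstar P n x = 0 := by
  -- At the starting date the state is `x` itself, so the almost sure statement no longer involves
  -- chance.
  have h' := (D.isTceqOptimalAt_iff c Wstar x (h n hn x).1 hn).1 (h n hn x) n le_rfl hn
  simp only [stateBefore_self] at h'
  exact h'.exists.choose_spec

/-- Forward, the gap-free control `R` is patched in wherever `P` has a gap, which almost surely is
never visited. Backward, a time consistent control has no gap anywhere, and equal decisions have
equal gaps. -/
lemma isTceqOptimalAt_zero_iff_exists_timeConsistent (hP : P ∈ D.admissible 0) :
    D.IsTceqOptimalAt c Wstar P 0 x ↔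
      ∃ P', D.IsTceqTimeConsistent c Wstar P' ∧ D.CoincidesAlong x P P' := by
  classical
  rw [D.isTceqOptimalAt_iff c Wstar x hP (Nat.zero_le _)]
  constructor
  · intro h
    obtain ⟨R, hR, hR0⟩ := D.exists_gap_eq_zero c Wstar
    set P' : Control := ⟨fun i y => if D.gap c Wstar P i y = 0 then P.q i y else R.q i y,
      fun i y => if D.gap c Wstar P i y = 0 then P.p i y else R.p i y⟩ with hP'def
    have hpos : ∀ i y, D.gap c Wstar P i y = 0 → P.q i y = P'.q i y ∧ P.p i y = P'.p i y :=
      fun i y hy => ⟨(if_pos hy).symm, (if_pos hy).symm⟩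
    have hneg : ∀ i y, D.gap c Wstar P i y ≠ 0 → R.q i y = P'.q i y ∧ R.p i y = P'.p i y :=
      fun i y hy => ⟨(if_neg hy).symm, (if_neg hy).symm⟩
    have hP' : P' ∈ D.admissible 0 := by
      intro i h0 hi
      -- Measurability of the gap keeps the patched control measurable.
      have hm : MeasurableSet {y | D.gap c Wstar P i y = 0} :=
        D.measurable_gap c Wstar (hP i h0 hi).1 (hP i h0 hi).2.1 (measurableSet_singleton 0)
      refine ⟨Measurable.ite hm (hP i h0 hi).1 (hR i h0 hi).1,
        Measurable.ite hm (hP i h0 hi).2.1 (hR i h0 hi).2.1, fun y => ?_⟩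
      rw [wealthAfter]
      by_cases hy : D.gap c Wstar P i y = 0
      · rw [← (hpos i y hy).1, ← (hpos i y hy).2]
        exact (hP i h0 hi).2.2 y
      · rw [← (hneg i y hy).1, ← (hneg i y hy).2]
        exact (hR i h0 hi).2.2 y
    have hgap : ∀ i ≤ D.M, ∀ y, D.gap c Wstar P' i y = 0 := by
      intro i hi y
      by_cases hy : D.gap c Wstar P i y = 0
      · rw [← hy, gap, gap, stateAfter, stateAfter, wealthAfter, wealthAfter,
          (hpos i y hy).1, (hpos i y hy).2]
      · rw [← hR0 i hi y, gap, gap, stateAfter, stateAfter, wealthAfter, wealthAfter,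
          (hneg i y hy).1, (hneg i y hy).2]
    refine ⟨P', fun n hn y => (D.isTceqOptimalAt_iff c Wstar y
      (D.admissible_mono n.zero_le hP') hn).2 fun i _ hi =>
        Filter.Eventually.of_forall fun ω => hgap i hi _, fun n hn => ?_⟩
    filter_upwards [h n n.zero_le hn] with ω hω
    exact hpos n _ hω
  · rintro ⟨P', hTC, hco⟩ i - hi
    filter_upwards [hco i hi] with ω hω
    rw [← hTC.gap_eq_zero hi (D.stateBefore P 0 x ω i), gap, gap, stateAfter, stateAfter,
      wealthAfter, wealthAfter, hω.1, hω.2]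

end

/-! ### The pre-commitment problem -/

lemma preObjective_eq {P : Control} (hP : P ∈ D.admissible 0) (W : ℝ) (x : State) :
    D.preObjective P W x = D.kappa * W + D.tceqObjective (D.kappa / D.alpha) W P 0 x := by
  have h : ∀ ω, D.withdrawals P 0 x ω
      + D.kappa * (W + 1 / D.alpha * min (D.terminalWealth P 0 x ω - W) 0) =
      D.kappa * W + (D.withdrawals P 0 x ω
        + D.kappa / D.alpha * min (D.terminalWealth P 0 x ω - W) 0) := fun ω => by ring
  have hint : Integrable (fun ω => D.withdrawals P 0 x ω
      + D.kappa / D.alpha * min (D.terminalWealth P 0 x ω - W) 0) D.pathLaw :=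
    (D.integrable_withdrawals x hP).add (D.integrable_shortfall _ W x hP (Nat.zero_le _))
  simp only [preObjective, tceqObjective, h]
  rw [integral_add (integrable_const _) hint]
  simp

lemma isPrecommitmentOptimal_iff {P : Control} (hP : P ∈ D.admissible 0) {Wstar : ℝ} {x : State}
    (hW : Wstar ∈ D.preArgmax x) :
    D.IsPrecommitmentOptimal P Wstar x ↔
      D.IsTceqOptimalAt (D.kappa / D.alpha) Wstar P 0 x := by
  have hval : D.preValue x = ⨆ P ∈ D.admissible 0, (D.preObjective P Wstar x : EReal) := by
    refine le_antisymm (iSup₂_le fun R hR => iSup_le fun W => ?_)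
      (iSup₂_mono fun R _ => le_iSup_of_le Wstar le_rfl)
    exact (le_iSup₂_of_le (f := fun R (_ : R ∈ D.admissible 0) => (D.preObjective R W x : EReal))
      R hR le_rfl).trans (hW (Set.mem_univ W))
  -- Attaining the supremum is restated as real inequalities between controls, from which the common
  -- constant `κ Wstar` cancels.
  have hsup : ∀ f : Control → ℝ, (f P : EReal) = ⨆ R ∈ D.admissible 0, (f R : EReal) ↔
      ∀ R ∈ D.admissible 0, f R ≤ f P := fun f => by
    have hle : (f P : EReal) ≤ ⨆ R ∈ D.admissible 0, (f R : EReal) :=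
      le_iSup₂_of_le (f := fun R (_ : R ∈ D.admissible 0) => (f R : EReal)) P hP le_rfl
    rw [le_antisymm_iff, and_iff_right hle, iSup₂_le_iff]
    simp only [EReal.coe_le_coe_iff]
  rw [IsPrecommitmentOptimal, IsTceqOptimalAt, hval, tceqValue, hsup fun R =>
    D.preObjective R Wstar x, hsup fun R => D.tceqObjective _ Wstar R 0 x]
  refine and_congr_right fun _ => forall₂_congr fun R hR => ?_
  rw [D.preObjective_eq hR, D.preObjective_eq hP, add_le_add_iff_left]

end Problem

end EWES

end

theorem mainTheorem2 (D : EWES.Problem) (W0 Wstar : ℝ)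
    (hWstar : Wstar ∈ D.preArgmax (0, W0))
    (P : EWES.Control) (hP : P ∈ D.admissible 0) :
    (D.IsPrecommitmentOptimal P Wstar (0, W0) ↔
      ∀ n ≤ D.M, ∀ᵐ ω ∂D.pathLaw,
        D.IsTceqOptimalAt (D.kappa / D.alpha) Wstar P n
          (D.stateBefore P 0 (0, W0) ω n)) ∧
    (D.IsPrecommitmentOptimal P Wstar (0, W0) ↔
      ∃ P' : EWES.Control,
        D.IsTceqTimeConsistent (D.kappa / D.alpha) Wstar P' ∧
        D.CoincidesAlong (0, W0) P P') := by
  rw [D.isPrecommitmentOptimal_iff hP hWstar]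
  exact ⟨D.isTceqOptimalAt_zero_iff_forall_tail _ Wstar _ hP,
    D.isTceqOptimalAt_zero_iff_exists_timeConsistent _ Wstar _ hP⟩
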